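/- Let $s\ge 1$, let $N\ge 0$ be even, $u\in\mathbb C$, and let $M_a\in\mathbb Z_{\ge0}$ and $v^{(a)}_k\in\mathbb C$ ($1\le a\le s$, $1\le k\le M_a$) be arbitrary (in particular, they may form a solution of the Bethe ansatz equation of the $osp(1|2s)$ quantum transfer matrix). Put $Q_0(v)=1$, $Q_a(v)=\prod_{k=1}^{M_a}(v-v^{(a)}_k)$, $\phi_\pm(v)=(v\pm iu)^{N/2}$, $M_0=N$, and let $J=\{1\prec 2\prec\dots\prec s\prec 0\prec\bar s\prec\dots\prec\bar2\prec\bar1\}$. Put $\zeta_a=\zeta_{\bar a}=(-1)^{M_{a-1}-M_a}$ for $1\le a\le s$ and $$\psi_1(v)=\zeta_1\frac{\phi_+(v)\phi_-(v+i)\phi_+(v-\frac{2s-1}{2}i)}{\phi_+(v-\frac{2s+1}{2}i)},\qquad \psi_{\bar1}(v)=\zeta_{\bar1}\frac{\phi_-(v)\phi_+(v-i)\phi_-(v+\frac{2s-1}{2}i)}{\phi_-(v+\frac{2s+1}{2}i)},$$ $\psi_0(v)=\phi_+(v)\phi_-(v)$, and $\psi_b(v)=\zeta_b\,\phi_+(v)\phi_-(v)$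 for $b\in\{2,\dots,s,\bar s,\dots,\bar 2\}$. For $1\le a\le s$ define the boxes $$z_a(v)=\psi_a(v)\frac{Q_{a-1}(v+\frac i2(a+1))\,Q_a(v+\frac i2(a-2))}{Q_{a-1}(v+\frac i2(a-1))\,Q_a(v+\frac i2a)},\qquad z_0(v)=\psi_0(v)\frac{Q_s(v+\frac i2(s-1))\,Q_s(v+\frac i2(s+2))}{Q_s(v+\frac i2(s+1))\,Q_s(v+\frac i2s)},$$ $$z_{\bar a}(v)=\psi_{\bar a}(v)\frac{Q_{a-1}(v-\frac i2(a-2s))\,Q_a(v-\frac i2(a-2s-3))}{Q_{a-1}(v-\frac i2(a-2s-2))\,Q_a(v-\frac i2(a-2s-1))}.$$ For $a,m\ge0$ let $$\mathcal T^{(a)}_m(v)=\sum_b\prod_{j=1}^m\prod_{k=1}^a z_{b(j,k)}\bigl(v-\tfrac i2(m-a-2j+2k)\bigr),$$ where $b$ runs over all fillings of the rectangle with $m$ rows and $a$ columns by elements of $J$ with $b(j,k)\prec b(j,k+1)$ and $b(j,k)\preceq b(j+1,k)$. Let $$\mathcal N^{(a)}_m(v)=\frac{\prod_{j=1}^m\prod_{k=1}^a\phi_-(v-\frac{m-a-2j+2k}{2}i)\,\phi_+(v-\frac{m-a-2j+2k}{2}i)}{\phi_-(v-\frac{m-a}2i)\,\phi_+(v+\frac{m-a}2i)},\qquad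 T^{(a)}_m(v)=\frac{\mathcal T^{(a)}_m(v)}{\mathcal N^{(a)}_m(v)}.$$ Then the following hold as identities between rational functions of $v$. For all $m\ge1$ and $1\le a\le s-1$, $$T^{(a)}_m(v+\tfrac i2)T^{(a)}_m(v-\tfrac i2)=T^{(a)}_{m+1}(v)T^{(a)}_{m-1}(v)+T^{(a-1)}_m(v)T^{(a+1)}_m(v),$$ and for all $m\ge1$, $$T^{(s)}_m(v+\tfrac i2)T^{(s)}_m(v-\tfrac i2)=T^{(s)}_{m+1}(v)T^{(s)}_{m-1}(v)+g^{(s)}_m(v)T^{(s-1)}_m(v)T^{(s)}_m(v),$$ where $$g^{(s)}_m(v)=\frac{\phi_-(v+\frac{m+s+1}2i)\,\phi_+(v-\frac{m+s+1}2i)}{\phi_-(v+\frac{m+s}2i)\,\phi_+(v-\frac{m+s}2i)},$$ and the boundary functions are $$T^{(a)}_0(v)=\phi_-(v+\tfrac a2i)\,\phi_+(v-\tfrac a2i)\quad(a\ge1),\qquad T^{(0)}_m(v)=\phi_-(v-\tfrac m2i)\,\phi_+(v+\tfrac m2i)\quad(m\ge1).$$ -/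

import Mathlib

open Complex

noncomputable section

/-- The data entering the dressed vacuum forms of the `osp(1|2s)` quantum transfer matrix: the rank
`s`, the Trotter number `N`, the parameter `u`, the numbers `M a` and the complex numbers
`root a k` (`1 ≤ a ≤ s`, `k < M a`); values at other indices are irrelevant. -/
structure OspData where
  s : ℕ
  N : ℕ
  u : ℂ
  M : ℕ → ℕ
  root : ℕ → ℕ → ℂ

namespace OspData

variable (D : OspData) {K : Type*} [Field K] [Algebra ℂ K]

/- All functions of the spectral parameter are given by formulas that make sense in any field
`K` containing `ℂ`.  With `K = RatFunc ℂ` and `v = RatFunc.X` they are rational functions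
of the indeterminate `v`. -/

/-- The complex number `c * i / 2`, as an element of `K`. -/
def hi (K : Type*) [Field K] [Algebra ℂ K] (c : ℤ) : K := algebraMap ℂ K ((c : ℂ) * I / 2)

/-- `Q_0 = 1`, and `Q_a(x) = ∏_k (x - v_k^{(a)})` for `a ≥ 1`. -/
def Q (a : ℕ) (x : K) : K :=
  if a = 0 then 1 else ∏ k ∈ Finset.range (D.M a), (x - algebraMap ℂ K (D.root a k))

/-- `φ₊(x) = (x + i u)^{N/2}`. -/
def phiP (x : K) : K := (x + algebraMap ℂ K (I * D.u)) ^ (D.N / 2)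

/-- `φ₋(x) = (x - i u)^{N/2}`. -/
def phiM (x : K) : K := (x - algebraMap ℂ K (I * D.u)) ^ (D.N / 2)

/-- The phase factor `ζ_a = ζ_{ā}` for `1 ≤ a ≤ s` (and `ζ_0 = 1`). -/
def zeta (K : Type*) [Field K] (a : ℕ) : K :=
  if a = 1 then (-1) ^ ((D.N : ℤ) - D.M 1) else (-1) ^ ((D.M (a - 1) : ℤ) - D.M a)

/-- The vacuum part `ψ_a`, `1 ≤ a ≤ s`. -/
def psi (a : ℕ) (v : K) : K :=
  D.zeta K a *
    if a = 1 then
      D.phiP v * D.phiM (v + hi K 2) * D.phiP (v - hi K (2 * D.s - 1))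
        / D.phiP (v - hi K (2 * D.s + 1))
    else D.phiP v * D.phiM v

/-- The vacuum part `ψ_0`. -/
def psiZero (v : K) : K := D.phiP v * D.phiM v

/-- The vacuum part `ψ_{ā}`, `1 ≤ a ≤ s`. -/
def psiBar (a : ℕ) (v : K) : K :=
  D.zeta K a *
    if a = 1 then
      D.phiM v * D.phiP (v - hi K 2) * D.phiM (v + hi K (2 * D.s - 1))
        / D.phiM (v + hi K (2 * D.s + 1))
    else D.phiP v * D.phiM v

/-- The box with entry `a`, `1 ≤ a ≤ s`. -/
def boxPlain (a : ℕ) (v : K) : K :=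
  D.psi a v *
    ((D.Q (a - 1) (v + hi K (a + 1)) * D.Q a (v + hi K (a - 2)))
      / (D.Q (a - 1) (v + hi K (a - 1)) * D.Q a (v + hi K a)))

/-- The box with entry `0`. -/
def boxZero (v : K) : K :=
  D.psiZero v *
    ((D.Q D.s (v + hi K (D.s - 1)) * D.Q D.s (v + hi K (D.s + 2)))
      / (D.Q D.s (v + hi K (D.s + 1)) * D.Q D.s (v + hi K D.s)))

/-- The box with entry `ā`, `1 ≤ a ≤ s`. -/
def boxBar (a : ℕ) (v : K) : K :=
  D.psiBar a v *
    ((D.Q (a - 1) (v - hi K (a - 2 * D.s)) * D.Q a (v - hi K (a - 2 * D.s - 3)))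
      / (D.Q (a - 1) (v - hi K (a - 2 * D.s - 2)) * D.Q a (v - hi K (a - 2 * D.s - 1))))

/-- The ordered alphabet `1 ≺ 2 ≺ ⋯ ≺ s ≺ 0 ≺ s̄ ≺ ⋯ ≺ 2̄ ≺ 1̄`, identified with
`0 < 1 < ⋯ < 2s` through the position of a letter. -/
abbrev Letter : Type := Fin (2 * D.s + 1)

/-- The box with a given letter: position `p < s` is the letter `p + 1`, position `s` is the
letter `0`, and position `p > s` is the letter `ā` with `a = 2s + 1 - p`. -/
def box (p : D.Letter) (v : K) : K :=
  if (p : ℕ) < D.s then D.boxPlain ((p : ℕ) + 1) v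
  else if (p : ℕ) = D.s then D.boxZero v
  else D.boxBar (2 * D.s + 1 - (p : ℕ)) v

/-- Admissible tableaux on the rectangle with `m` rows and `a` columns: strictly increasing
along rows, weakly increasing down columns. -/
def Admissible {m a : ℕ} (b : Fin m → Fin a → D.Letter) : Prop :=
  (∀ i, StrictMono (b i)) ∧ ∀ j, Monotone fun i => b i j

open Classical in
/-- The dressed vacuum form of the rectangle `(a^m)` (`m` rows, `a` columns).  Rows and columns
are counted from `0` instead of `1`, which does not change `-2j+2k`. -/
def dvf (a m : ℕ) (v : K) : K :=
  ∑ b : Fin m → Fin a → D.Letter with D.Admissible b,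
    ∏ j : Fin m, ∏ k : Fin a,
      D.box (b j k) (v - hi K (-(a : ℤ) + m - 2 * (j : ℕ) + 2 * (k : ℕ)))

/-- The normalisation function `𝒩^{(a)}_m`. -/
def norm (a m : ℕ) (v : K) : K :=
  (∏ j : Fin m, ∏ k : Fin a,
      (D.phiM (v - hi K ((m : ℤ) - a - 2 * (j : ℕ) + 2 * (k : ℕ)))
        * D.phiP (v - hi K ((m : ℤ) - a - 2 * (j : ℕ) + 2 * (k : ℕ)))))
    / (D.phiM (v - hi K ((m : ℤ) - a)) * D.phiP (v + hi K ((m : ℤ) - a)))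

/-- The normalised function `T^{(a)}_m`. -/
def T (a m : ℕ) (v : K) : K := D.dvf a m v / D.norm a m v

/-- The function `g^{(s)}_m`. -/
def g (m : ℕ) (v : K) : K :=
  (D.phiM (v + hi K (m + D.s + 1)) * D.phiP (v - hi K (m + D.s + 1)))
    / (D.phiM (v + hi K (m + D.s)) * D.phiP (v - hi K (m + D.s)))

end OspData

end

/-!
The position of a box in a tableau shifts the spectral parameter, so the Jacobi–Trudi formula is
needed for position-dependent weights. Both the tableau sum and the determinant can be expanded
in the largest letter: in the determinant every row splits into a part without that letter and a
part with one box removed, and multilinearity gives the same recursion as for tableaux. The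
T-system is then the Desnanot–Jacobi identity for the determinant of a rectangle.

The system closes at `a = s` because the elementary sums of degrees `r` and `2 s + 1 - r` in the
alphabet `1 ≺ ⋯ ≺ s ≺ 0 ≺ s̄ ≺ ⋯ ≺ 1̄` are proportional. This follows by removing the two outer
letters `k` and `k̄`, whose boxes almost cancel each other, and induction on the rank. The factors
of proportionality only involve `Q_0`, which is replaced by a product of `φ₋` and `φ₊` generating
the vacuum parts; on rectangles they telescope to `g`.
-/

section Determinants

open Matrix

variable {R : Type*} [CommRing R]

theorem det_mul_det_toBlocks₂₂_adjugate {m n : Type*} [Fintype m] [DecidableEq m] [Fintype n]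
    [DecidableEq n] (M : Matrix (m ⊕ n) (m ⊕ n) R) :
    M.det * M.adjugate.toBlocks₂₂.det = M.toBlocks₁₁.det * M.det ^ Fintype.card n := by
  have hcol : fromBlocks M.toBlocks₁₁ M.toBlocks₁₂ M.toBlocks₂₁ M.toBlocks₂₂
      * fromBlocks M.adjugate.toBlocks₁₁ M.adjugate.toBlocks₁₂
        M.adjugate.toBlocks₂₁ M.adjugate.toBlocks₂₂ = M.det • fromBlocks 1 0 0 1 := by
    rw [fromBlocks_toBlocks, fromBlocks_toBlocks, mul_adjugate, fromBlocks_one]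
  rw [fromBlocks_multiply, fromBlocks_smul, fromBlocks_inj] at hcol
  have hmul : M * fromBlocks 1 M.adjugate.toBlocks₁₂ 0 M.adjugate.toBlocks₂₂
      = fromBlocks M.toBlocks₁₁ 0 M.toBlocks₂₁ (M.det • 1) := by
    nth_rewrite 1 [← fromBlocks_toBlocks M]
    rw [fromBlocks_multiply, hcol.2.1, hcol.2.2.2]
    simp only [Matrix.mul_one, Matrix.mul_zero, add_zero, smul_zero]
  simpa only [det_mul, det_fromBlocks_zero₂₁, det_fromBlocks_zero₁₂, det_smul, det_one, one_mul,
    mul_one] using congrArg det hmul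

theorem det_toBlocks₂₂_adjugate {m n : Type*} [Fintype m] [DecidableEq m] [Fintype n]
    [DecidableEq n] [Nonempty n] (M : Matrix (m ⊕ n) (m ⊕ n) R) :
    M.adjugate.toBlocks₂₂.det = M.toBlocks₁₁.det * M.det ^ (Fintype.card n - 1) := by
  -- Both sides are polynomials in the entries, so the determinant may be assumed regular.
  let X := mvPolynomialX (m ⊕ n) (m ⊕ n) ℤ
  let eval := MvPolynomial.aeval (R := ℤ) fun p : (m ⊕ n) × (m ⊕ n) => M p.1 p.2
  have hX : X.adjugate.toBlocks₂₂.det = X.toBlocks₁₁.det * X.det ^ (Fintype.card n - 1) := by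
    apply mul_left_cancel₀ (det_mvPolynomialX_ne_zero (m ⊕ n) ℤ)
    rw [det_mul_det_toBlocks₂₂_adjugate, mul_left_comm, ← pow_succ',
      Nat.sub_add_cancel Fintype.card_pos]
  have hM : eval.mapMatrix X = M := mvPolynomialX_mapMatrix_aeval ℤ M
  have hadj : eval.mapMatrix X.adjugate.toBlocks₂₂ = M.adjugate.toBlocks₂₂ := by
    rw [← hM, ← AlgHom.map_adjugate]
    rfl
  have hblock : eval.mapMatrix X.toBlocks₁₁ = M.toBlocks₁₁ := by
    rw [← hM]
    rfl
  simpa only [map_mul, map_pow, AlgHom.map_det, hM, hadj, hblock] using congrArg eval hX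

theorem desnanot_jacobi {m : ℕ} (A : Matrix (Fin (m + 2)) (Fin (m + 2)) R) :
    (A.submatrix Fin.succ Fin.succ).det * (A.submatrix Fin.castSucc Fin.castSucc).det
      = A.det * (A.submatrix (fun i : Fin m => i.succ.castSucc) fun j => j.succ.castSucc).det
        + (A.submatrix Fin.succ Fin.castSucc).det * (A.submatrix Fin.castSucc Fin.succ).det := by
  have hinj : Function.Injective
      (Sum.elim (fun i : Fin m => i.succ.castSucc) ![0, Fin.last (m + 1)]) := by
    refine Function.Injective.sumElim
      ((Fin.castSucc_injective _).comp (Fin.succ_injective _)) ?_ ?_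
    · intro i j
      fin_cases i <;> fin_cases j <;> simp [Fin.ext_iff]
    · intro i j
      fin_cases j <;> simp [Fin.ext_iff, i.is_lt.ne]
  let e : Fin m ⊕ Fin 2 ≃ Fin (m + 2) :=
    .ofBijective _ ((Fintype.bijective_iff_injective_and_card _).2 ⟨hinj, by simp⟩)
  have hminor : A.adjugate 0 0 * A.adjugate (Fin.last _) (Fin.last _)
        - A.adjugate 0 (Fin.last _) * A.adjugate (Fin.last _) 0
      = (A.submatrix (fun i : Fin m => i.succ.castSucc) fun j => j.succ.castSucc).det * A.det := by
    have h := det_toBlocks₂₂_adjugate (A.submatrix e e)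
    rw [adjugate_submatrix_equiv_self, det_submatrix_equiv_self, Fintype.card_fin, pow_one,
      det_fin_two] at h
    exact h
  simp only [adjugate_fin_succ_eq_det_submatrix, Fin.succAbove_zero, Fin.succAbove_last,
    Fin.val_zero, Fin.val_last, add_zero, zero_add, pow_zero, one_mul, ← two_mul,
    pow_mul, neg_one_sq, one_pow] at hminor
  have hsign : ((-1 : R) ^ (m + 1)) * (-1) ^ (m + 1) = 1 := by
    rw [← mul_pow, neg_one_mul, neg_neg, one_pow]
  linear_combination hminor + (A.submatrix Fin.succ Fin.castSucc).det
    * (A.submatrix Fin.castSucc Fin.succ).det * hsign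

end Determinants

section ElementarySums

variable {R : Type*} [CommSemiring R]

/-- The elementary sum of degree `r` in the first `n` letters: the sum over all strictly increasing
words `p₀ < ⋯ < p_{r-1} < n` of `∏ k, y p_k (c + r - 1 - 2 k)`, where `y p x` is the weight of the
letter `p` at position `x`. The positions are arranged symmetrically around `c`. -/
def elemSum (y : ℕ → ℤ → R) : ℕ → ℤ → ℤ → R
  | 0, r, _ => if r = 0 then 1 else 0
  | n + 1, r, c => elemSum y n r c + y n (c - r + 1) * elemSum y n (r - 1) (c + 1)

theorem elemSum_zero (y : ℕ → ℤ → R) (r c : ℤ) : elemSum y 0 r c = if r = 0 then 1 else 0 := rfl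

theorem elemSum_succ (y : ℕ → ℤ → R) (n : ℕ) (r c : ℤ) :
    elemSum y (n + 1) r c = elemSum y n r c + y n (c - r + 1) * elemSum y n (r - 1) (c + 1) := rfl

theorem elemSum_succ' (y : ℕ → ℤ → R) (n : ℕ) (r c : ℤ) :
    elemSum y (n + 1) r c = elemSum (fun p => y (p + 1)) n r c
      + y 0 (c + r - 1) * elemSum (fun p => y (p + 1)) n (r - 1) (c - 1) := by
  induction n generalizing r c with
  | zero =>
    rcases eq_or_ne r 1 with rfl | hr
    · simp [elemSum_succ, elemSum_zero]
    · simp [elemSum_succ, elemSum_zero, sub_ne_zero.2 hr]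
  | succ n ih =>
    rw [elemSum_succ, ih, ih, elemSum_succ, elemSum_succ _ n (r - 1),
      show c - 1 - (r - 1) + 1 = c - r + 1 by ring, show c + 1 + (r - 1) - 1 = c + r - 1 by ring,
      sub_add_cancel, add_sub_cancel_right]
    ring

theorem elemSum_add_two (y : ℕ → ℤ → R) (n : ℕ) (r c : ℤ) :
    elemSum y (n + 2) r c = elemSum (fun p => y (p + 1)) n r c
      + y 0 (c + r - 1) * elemSum (fun p => y (p + 1)) n (r - 1) (c - 1)
      + y (n + 1) (c - r + 1) * elemSum (fun p => y (p + 1)) n (r - 1) (c + 1)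
      + y 0 (c + r - 1) * y (n + 1) (c - r + 1) * elemSum (fun p => y (p + 1)) n (r - 2) c := by
  rw [elemSum_succ, elemSum_succ', elemSum_succ', show c + 1 + (r - 1) - 1 = c + r - 1 by ring,
    show r - 1 - 1 = r - 2 by ring, add_sub_cancel_right]
  ring

end ElementarySums

section JacobiTrudi

variable {R : Type*} [CommRing R]

/-- The Jacobi–Trudi determinant of the shape with row lengths `l`. The box in row `i` and column
`k`, both counted from `0`, sits at position `u + 2 * (i - k)`. -/
def jacobiTrudi (y : ℕ → ℤ → R) (n : ℕ) {m : ℕ} (l : Fin m → ℤ) (u : ℤ) : R :=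
  (Matrix.of fun i j : Fin m => elemSum y n (l i - i + j) (u - l i + i + j + 1)).det

/-- The shape `l` with the last box of every row in `s` removed. -/
def removeBoxes {m : ℕ} (l : Fin m → ℤ) (s : Finset (Fin m)) : Fin m → ℤ :=
  fun i => if i ∈ s then l i - 1 else l i

theorem jacobiTrudi_zero (y : ℕ → ℤ → R) {m : ℕ} {l : Fin m → ℤ} (hl : Antitone l) (u : ℤ) :
    jacobiTrudi y 0 l u = if l = 0 then 1 else 0 := by
  split_ifs with h0
  · have hentry (i j : Fin m) : (0 - (i : ℤ) + j = 0) ↔ i = j := by omega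
    simp only [jacobiTrudi, h0, Pi.zero_apply, elemSum_zero, hentry]
    exact Matrix.det_one
  · cases m with
    | zero => exact absurd (Subsingleton.elim l 0) h0
    | succ m =>
      obtain hpos | hneg : 0 < l 0 ∨ l (Fin.last m) < 0 := by
        by_contra! h
        exact h0 (funext fun i => le_antisymm ((hl (Fin.zero_le i)).trans h.1)
          (h.2.trans (hl (Fin.le_last i))))
      · refine Matrix.det_eq_zero_of_row_eq_zero 0 fun j => ?_
        rw [Matrix.of_apply, elemSum_zero, if_neg]
        simp only [Fin.val_zero]
        omega
      · refine Matrix.det_eq_zero_of_row_eq_zero (Fin.last m) fun j => ?_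
        rw [Matrix.of_apply, elemSum_zero, if_neg]
        simp only [Fin.val_last]
        omega

theorem jacobiTrudi_succ (y : ℕ → ℤ → R) (n : ℕ) {m : ℕ} (l : Fin m → ℤ) (u : ℤ) :
    jacobiTrudi y (n + 1) l u = ∑ s : Finset (Fin m),
      (∏ i ∈ s, y n (u + 2 * (i - l i + 1))) * jacobiTrudi y n (removeBoxes l s) u := by
  let keep : Fin m → Fin m → R := fun i j => elemSum y n (l i - i + j) (u - l i + i + j + 1)
  let remove : Fin m → Fin m → R := fun i j =>
    y n (u + 2 * (i - l i + 1)) * elemSum y n (l i - 1 - i + j) (u - (l i - 1) + i + j + 1)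
  have hrows : jacobiTrudi y (n + 1) l u = Matrix.detRowAlternating (remove + keep) := by
    refine congrArg Matrix.det (Matrix.ext fun i j => ?_)
    rw [Matrix.of_apply, elemSum_succ, add_comm, Pi.add_apply, Pi.add_apply]
    simp only [remove, keep]
    ring_nf
  rw [hrows, AlternatingMap.map_add_univ]
  refine Finset.sum_congr rfl fun s _ => ?_
  have hprod : ∏ i ∈ s, y n (u + 2 * (i - l i + 1))
      = ∏ i, if i ∈ s then y n (u + 2 * (i - l i + 1)) else 1 := by
    rw [Finset.prod_ite_mem, Finset.univ_inter]
  rw [hprod, jacobiTrudi, ← Matrix.det_mul_column]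
  refine congrArg Matrix.det (Matrix.ext fun i j => ?_)
  by_cases hi : i ∈ s <;> simp [hi, remove, keep, removeBoxes]

theorem jacobiTrudi_eq_zero_of_succ_eq (y : ℕ → ℤ → R) (n : ℕ) {m : ℕ} {l : Fin (m + 1) → ℤ}
    {i : Fin m} (hi : l i.succ = l i.castSucc + 1) (u : ℤ) : jacobiTrudi y n l u = 0 := by
  refine Matrix.det_zero_of_row_eq (Fin.castSucc_lt_succ (i := i)).ne ?_
  ext j
  simp only [Matrix.of_apply, hi, Fin.val_castSucc, Fin.val_succ]
  push_cast
  ring_nf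

theorem jacobiTrudi_removeBoxes_eq_zero (y : ℕ → ℤ → R) (n : ℕ) {m : ℕ} {l : Fin m → ℤ}
    (hl : Antitone l) {s : Finset (Fin m)} (hs : ¬ Antitone (removeBoxes l s)) (u : ℤ) :
    jacobiTrudi y n (removeBoxes l s) u = 0 := by
  cases m with
  | zero => exact absurd (fun i => i.elim0) hs
  | succ m =>
    obtain ⟨i, hi⟩ : ∃ i : Fin m, removeBoxes l s i.castSucc < removeBoxes l s i.succ := by
      simpa only [Fin.antitone_iff_succ_le, not_forall, not_le] using hs
    have hli : l i.succ ≤ l i.castSucc := hl Fin.castSucc_lt_succ.le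
    refine jacobiTrudi_eq_zero_of_succ_eq y n (i := i) ?_ u
    simp only [removeBoxes] at hi ⊢
    split_ifs at hi ⊢ <;> omega

/-- The Jacobi–Trudi determinant of the rectangle with `m` rows and `a` columns whose boxes are
arranged symmetrically around the position `c`. -/
def rectangleDet (y : ℕ → ℤ → R) (n : ℕ) (a : ℤ) (m : ℕ) (c : ℤ) : R :=
  jacobiTrudi y n (fun _ : Fin m => a) (c + a - m)

theorem rectangleDet_eq_det (y : ℕ → ℤ → R) (n : ℕ) (a : ℤ) (m : ℕ) (c : ℤ) :
    rectangleDet y n a m c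
      = (Matrix.of fun i j : Fin m => elemSum y n (a - i + j) (c + i + j + 1 - m)).det := by
  rw [rectangleDet, jacobiTrudi]
  refine congrArg Matrix.det (Matrix.ext fun i j => ?_)
  rw [Matrix.of_apply, Matrix.of_apply, show c + a - m - a + i + j + 1 = c + i + j + 1 - m by ring]

theorem rectangleDet_mul_rectangleDet (y : ℕ → ℤ → R) (n m : ℕ) (a c : ℤ) :
    rectangleDet y n a (m + 1) (c + 1) * rectangleDet y n a (m + 1) (c - 1)
      = rectangleDet y n a (m + 2) c * rectangleDet y n a m c
        + rectangleDet y n (a - 1) (m + 1) c * rectangleDet y n (a + 1) (m + 1) c := by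
  have hdj := desnanot_jacobi
    (Matrix.of fun i j : Fin (m + 2) => elemSum y n (a - i + j) (c + i + j + 1 - (m + 2)))
  simp only [rectangleDet_eq_det]
  convert hdj using 3 <;> (try refine congrArg Matrix.det ?_) <;> ext i j <;>
    simp only [Matrix.submatrix_apply, Matrix.of_apply, Fin.val_succ, Fin.val_castSucc] <;>
    push_cast <;> ring_nf

end JacobiTrudi

section Tableaux

variable {m n : ℕ}

/-- The length of row `j` of the subtableau formed by the letters below `p`, when a tableau with
strictly increasing rows is encoded by the sets `S q` of rows containing the letter `q`. -/
def rowLengthBelow (S : Fin n → Finset (Fin m)) (p : ℕ) (j : Fin m) : ℤ :=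
  (Finset.univ.filter fun q : Fin n => (q : ℕ) < p ∧ j ∈ S q).card

/-- The sets `S q` of rows containing the letter `q` form a semistandard tableau of shape `l`
(strict in rows, weak in columns): the letters below any given one fill a shape, and all letters
together fill `l`. -/
def IsTableau (l : Fin m → ℤ) (S : Fin n → Finset (Fin m)) : Prop :=
  (∀ p ≤ n, Antitone (rowLengthBelow S p)) ∧ rowLengthBelow S n = l

theorem rowLengthBelow_zero (S : Fin n → Finset (Fin m)) : rowLengthBelow S 0 = 0 := by
  ext j
  simp [rowLengthBelow]

theorem rowLengthBelow_snoc_of_le (S : Fin n → Finset (Fin m)) (s : Finset (Fin m)) {p : ℕ}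
    (hp : p ≤ n) :
    rowLengthBelow (Fin.snoc S s : Fin (n + 1) → Finset (Fin m)) p = rowLengthBelow S p := by
  ext j
  rw [rowLengthBelow, rowLengthBelow, Finset.card_filter, Finset.card_filter,
    Fin.sum_univ_castSucc]
  simp [Nat.not_lt.2 hp]

theorem rowLengthBelow_snoc_succ (S : Fin n → Finset (Fin m)) (s : Finset (Fin m)) (j : Fin m) :
    rowLengthBelow (Fin.snoc S s : Fin (n + 1) → Finset (Fin m)) (n + 1) j
      = rowLengthBelow S n j + if j ∈ s then 1 else 0 := by
  rw [rowLengthBelow, rowLengthBelow, Finset.card_filter, Finset.card_filter,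
    Fin.sum_univ_castSucc]
  have hlt (q : Fin n) : (q : ℕ) < n + 1 := q.is_lt.trans n.lt_succ_self
  simp [hlt]

theorem isTableau_snoc_iff {l : Fin m → ℤ} (hl : Antitone l) (S : Fin n → Finset (Fin m))
    (s : Finset (Fin m)) :
    IsTableau l (Fin.snoc S s : Fin (n + 1) → Finset (Fin m)) ↔ IsTableau (removeBoxes l s) S := by
  have hshape : rowLengthBelow (Fin.snoc S s : Fin (n + 1) → Finset (Fin m)) (n + 1) = l
      ↔ rowLengthBelow S n = removeBoxes l s := by
    simp only [funext_iff, rowLengthBelow_snoc_succ, removeBoxes]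
    refine forall_congr' fun j => ?_
    split_ifs <;> omega
  rw [IsTableau, IsTableau, hshape]
  refine and_congr_left fun h => ⟨fun H p hp => ?_, fun H p hp => ?_⟩
  · rw [← rowLengthBelow_snoc_of_le S s hp]
    exact H p (hp.trans n.le_succ)
  · rcases Nat.le_succ_iff.1 hp with hpn | rfl
    · rw [rowLengthBelow_snoc_of_le S s hpn]
      exact H p hpn
    · rw [hshape.2 h]
      exact hl

/-- The weight of the tableau encoded by `S`, the box in row `j` and column `k` being at position
`u + 2 * (j - k)`. -/
def tableauWeight {R : Type*} [CommMonoid R] (y : ℕ → ℤ → R) (u : ℤ)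
    (S : Fin n → Finset (Fin m)) : R :=
  ∏ p, ∏ j ∈ S p, y p (u + 2 * (j - rowLengthBelow S p j))

theorem tableauWeight_snoc {R : Type*} [CommMonoid R] (y : ℕ → ℤ → R) (u : ℤ)
    (S : Fin n → Finset (Fin m)) (s : Finset (Fin m)) :
    tableauWeight y u (Fin.snoc S s : Fin (n + 1) → Finset (Fin m))
      = (∏ j ∈ s, y n (u + 2 * (j - rowLengthBelow S n j))) * tableauWeight y u S := by
  rw [tableauWeight, Fin.prod_univ_castSucc, mul_comm, tableauWeight]
  congr 1
  · simp only [Fin.snoc_last, Fin.val_last, rowLengthBelow_snoc_of_le S s le_rfl]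
  · refine Finset.prod_congr rfl fun p _ => ?_
    simp only [Fin.snoc_castSucc, Fin.val_castSucc, rowLengthBelow_snoc_of_le S s p.is_lt.le]

open Classical in
/-- The generating function of the semistandard tableaux of shape `l` in the first `n` letters. -/
noncomputable def tableauSum {R : Type*} [CommSemiring R] (y : ℕ → ℤ → R) (n : ℕ)
    (l : Fin m → ℤ) (u : ℤ) : R :=
  ∑ S : Fin n → Finset (Fin m) with IsTableau l S, tableauWeight y u S

section

variable {R : Type*} [CommSemiring R] (y : ℕ → ℤ → R) (u : ℤ)

theorem tableauSum_zero (l : Fin m → ℤ) : tableauSum y 0 l u = if l = 0 then 1 else 0 := by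
  classical
  have htab (S : Fin 0 → Finset (Fin m)) : IsTableau l S ↔ l = 0 := by
    simp only [IsTableau, Nat.le_zero, forall_eq, rowLengthBelow_zero]
    exact ⟨fun h => h.2.symm, fun h => ⟨antitone_const, h.symm⟩⟩
  rw [tableauSum, Finset.sum_filter, Fintype.sum_unique]
  simp only [htab, tableauWeight, Finset.univ_eq_empty, Finset.prod_empty]

theorem tableauSum_eq_zero_of_not_antitone (n : ℕ) {l : Fin m → ℤ} (hl : ¬ Antitone l) :
    tableauSum y n l u = 0 := by
  classical
  rw [tableauSum, Finset.filter_false_of_mem, Finset.sum_empty]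
  rintro S - ⟨hshapes, rfl⟩
  exact hl (hshapes n le_rfl)

theorem tableauSum_succ (n : ℕ) {l : Fin m → ℤ} (hl : Antitone l) :
    tableauSum y (n + 1) l u = ∑ s : Finset (Fin m),
      (∏ j ∈ s, y n (u + 2 * (j - l j + 1))) * tableauSum y n (removeBoxes l s) u := by
  classical
  rw [tableauSum, Finset.sum_filter,
    ← Equiv.sum_comp (Fin.snocEquiv fun _ : Fin (n + 1) => Finset (Fin m)), Fintype.sum_prod_type]
  refine Finset.sum_congr rfl fun s _ => ?_
  rw [tableauSum, Finset.mul_sum, Finset.sum_filter]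
  refine Finset.sum_congr rfl fun S _ => ?_
  refine if_ctx_congr (isTableau_snoc_iff hl S s) (fun hS => ?_) fun _ => rfl
  refine (tableauWeight_snoc y u S s).trans ?_
  congr 1
  refine Finset.prod_congr rfl fun j hj => ?_
  rw [hS.2, removeBoxes, if_pos hj, sub_sub_eq_add_sub, add_sub_right_comm]

end

section

variable {R : Type*} [CommRing R] (y : ℕ → ℤ → R) (u : ℤ)

/- Only antitone shapes carry tableaux, but removing boxes may destroy antitonicity: then some row
exceeds the row above it by exactly one, and two rows of the determinant coincide. -/
theorem tableauSum_eq_jacobiTrudi (n : ℕ) {l : Fin m → ℤ} (hl : Antitone l) :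
    tableauSum y n l u = jacobiTrudi y n l u := by
  induction n generalizing l with
  | zero => rw [tableauSum_zero, jacobiTrudi_zero y hl]
  | succ n ih =>
    rw [tableauSum_succ y u n hl, jacobiTrudi_succ]
    refine Finset.sum_congr rfl fun s _ => ?_
    by_cases hs : Antitone (removeBoxes l s)
    · rw [ih hs]
    · rw [tableauSum_eq_zero_of_not_antitone y u n hs, jacobiTrudi_removeBoxes_eq_zero y n hl hs]

end

end Tableaux

section RectangularTableaux

variable {m a n : ℕ}

/-- The set of rows of the filling `b` that contain the letter `p`. -/
def rowsContaining (b : Fin m → Fin a → Fin n) (p : Fin n) : Finset (Fin m) :=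
  Finset.univ.filter fun j => ∃ k, b j k = p

theorem mem_rowsContaining {b : Fin m → Fin a → Fin n} {p : Fin n} {j : Fin m} :
    j ∈ rowsContaining b p ↔ ∃ k, b j k = p := by
  simp only [rowsContaining, Finset.mem_filter, Finset.mem_univ, true_and]

section

variable {b : Fin m → Fin a → Fin n} (hb : ∀ j, StrictMono (b j))

include hb

theorem rowLengthBelow_rowsContaining (p : ℕ) (j : Fin m) :
    rowLengthBelow (rowsContaining b) p j
      = (Finset.univ.filter fun k : Fin a => (b j k : ℕ) < p).card := by
  rw [rowLengthBelow, ← Finset.card_map ⟨b j, (hb j).injective⟩]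
  congr 2
  ext q
  simp only [mem_rowsContaining, Finset.mem_filter, Finset.mem_univ, true_and, Finset.mem_map,
    Function.Embedding.coeFn_mk]
  constructor
  · rintro ⟨hq, k, rfl⟩
    exact ⟨k, hq, rfl⟩
  · rintro ⟨k, hk, rfl⟩
    exact ⟨hk, k, rfl⟩

theorem rowLengthBelow_rowsContaining_apply (j : Fin m) (k : Fin a) :
    rowLengthBelow (rowsContaining b) (b j k) j = k := by
  have hIio : (Finset.univ.filter fun k' : Fin a => (b j k' : ℕ) < b j k) = Finset.Iio k := by
    ext k'
    simp [(hb j).lt_iff_lt]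
  rw [rowLengthBelow_rowsContaining hb, hIio, Fin.card_Iio]

theorem isTableau_rowsContaining_iff :
    IsTableau (fun _ => (a : ℤ)) (rowsContaining b) ↔ ∀ k, Monotone fun j => b j k := by
  constructor
  · rintro ⟨hshapes, -⟩ k j j' hj
    by_contra! hlt
    have hle := hshapes (b j k) (b j k).is_lt.le hj
    rw [rowLengthBelow_rowsContaining_apply hb, rowLengthBelow_rowsContaining hb,
      Nat.cast_le] at hle
    have hIic : Finset.Iic k ⊆ Finset.univ.filter fun k' : Fin a => (b j' k' : ℕ) < b j k := by
      intro k' hk'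
      simpa using ((hb j').monotone (Finset.mem_Iic.1 hk')).trans_lt hlt
    have hcard := Finset.card_le_card hIic
    rw [Fin.card_Iic] at hcard
    omega
  · intro hmono
    refine ⟨fun p _ j j' hj => ?_, funext fun j => ?_⟩
    · rw [rowLengthBelow_rowsContaining hb, rowLengthBelow_rowsContaining hb, Nat.cast_le]
      exact Finset.card_le_card (Finset.monotone_filter_right _ fun k _ hk =>
        (Fin.le_def.1 (hmono k hj)).trans_lt hk)
    · simp [rowLengthBelow_rowsContaining hb]

theorem tableauWeight_rowsContaining {R : Type*} [CommMonoid R] (y : ℕ → ℤ → R) (u : ℤ) :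
    tableauWeight y u (rowsContaining b) = ∏ j, ∏ k, y (b j k) (u + 2 * (j - k)) := by
  calc tableauWeight y u (rowsContaining b)
      = ∏ j, ∏ p ∈ Finset.univ.map ⟨b j, (hb j).injective⟩,
          y p (u + 2 * (j - rowLengthBelow (rowsContaining b) p j)) :=
        Finset.prod_comm' fun p j => by simp [mem_rowsContaining]
    _ = ∏ j, ∏ k, y (b j k) (u + 2 * (j - k)) := by
        simp only [Finset.prod_map, Function.Embedding.coeFn_mk,
          rowLengthBelow_rowsContaining_apply hb]

theorem rowsContaining_inj {b' : Fin m → Fin a → Fin n} (hb' : ∀ j, StrictMono (b' j)) :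
    rowsContaining b = rowsContaining b' ↔ b = b' := by
  refine ⟨fun h => funext fun j => ?_, congrArg _⟩
  rw [← (hb j).range_inj (hb' j)]
  ext p
  rw [Set.mem_range, Set.mem_range, ← mem_rowsContaining, ← mem_rowsContaining, h]

end

theorem exists_strictMono_rowsContaining_eq {S : Fin n → Finset (Fin m)}
    (hS : rowLengthBelow S n = fun _ => (a : ℤ)) :
    ∃ b : Fin m → Fin a → Fin n, (∀ j, StrictMono (b j)) ∧ rowsContaining b = S := by
  have hcard (j : Fin m) : (Finset.univ.filter fun q : Fin n => j ∈ S q).card = a := by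
    simpa [rowLengthBelow] using congrFun hS j
  refine ⟨fun j => (Finset.univ.filter fun q => j ∈ S q).orderEmbOfFin (hcard j),
    fun j => OrderEmbedding.strictMono _, ?_⟩
  ext p j
  rw [mem_rowsContaining, ← Set.mem_range, Finset.range_orderEmbOfFin, Finset.mem_coe,
    Finset.mem_filter_univ]

open Classical in
theorem sum_rectangle_eq_jacobiTrudi {R : Type*} [CommRing R] (y : ℕ → ℤ → R) (m a n : ℕ)
    (u : ℤ) :
    ∑ b : Fin m → Fin a → Fin n with (∀ j, StrictMono (b j)) ∧ ∀ k, Monotone fun j => b j k,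
      ∏ j, ∏ k, y (b j k) (u + 2 * (j - k)) = jacobiTrudi y n (fun _ : Fin m => (a : ℤ)) u := by
  rw [← tableauSum_eq_jacobiTrudi y u n antitone_const, tableauSum]
  refine Finset.sum_nbij rowsContaining ?_ ?_ ?_ ?_
  · intro b hb
    rw [Finset.mem_filter_univ] at hb ⊢
    exact (isTableau_rowsContaining_iff hb.1).2 hb.2
  · intro b hb b' hb' h
    rw [Finset.mem_coe, Finset.mem_filter_univ] at hb hb'
    exact (rowsContaining_inj hb.1 hb'.1).1 h
  · intro S hS
    rw [Finset.mem_coe, Finset.mem_filter_univ] at hS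
    obtain ⟨b, hb, rfl⟩ := exists_strictMono_rowsContaining_eq hS.2
    refine ⟨b, ?_, rfl⟩
    rw [Finset.mem_coe, Finset.mem_filter_univ]
    exact ⟨hb, (isTableau_rowsContaining_iff hb).1 hS⟩
  · intro b hb
    rw [Finset.mem_filter_univ] at hb
    exact (tableauWeight_rowsContaining hb.1 y u).symm

end RectangularTableaux

section Duality

variable {K : Type*} [Field K]

/-- The weight of the letter `k + 1`, with the vacuum part reduced to its sign `z k`. -/
def plainLetter (z : ℕ → K) (q : ℕ → ℤ → K) (k : ℕ) (c : ℤ) : K :=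
  z k * (q k (c + k + 2) * q (k + 1) (c + k - 1) / (q k (c + k) * q (k + 1) (c + k + 1)))

/-- The weight of the letter `0`, with trivial vacuum part. -/
def zeroLetter (s : ℕ) (q : ℕ → ℤ → K) (c : ℤ) : K :=
  q s (c + s - 1) * q s (c + s + 2) / (q s (c + s + 1) * q s (c + s))

/-- The weight of the barred letter `k + 1`, with the vacuum part reduced to its sign `z k`. -/
def barLetter (s : ℕ) (z : ℕ → K) (q : ℕ → ℤ → K) (k : ℕ) (c : ℤ) : K :=
  z k * (q k (c - k + 2 * s - 1) * q (k + 1) (c - k + 2 * s + 2)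
    / (q k (c - k + 2 * s + 1) * q (k + 1) (c - k + 2 * s)))

/-- The weights of the alphabet `1 ≺ ⋯ ≺ s ≺ 0 ≺ s̄ ≺ ⋯ ≺ 1̄`, indexed by position from `0`. -/
def ospLetter (s : ℕ) (z : ℕ → K) (q : ℕ → ℤ → K) (p : ℕ) : ℤ → K :=
  if p < s then plainLetter z q p
  else if p = s then zeroLetter s q
  else barLetter s z q (2 * s - p)

/-- The ratio of the elementary sums of degrees `r` and `2 * (s - k) + 1 - r` in the subalphabet
from the letter `k + 1` to the barred letter `k + 1`. -/
def dualFactor (s : ℕ) (q : ℕ → ℤ → K) (k : ℕ) (r c : ℤ) : K :=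
  q k (c + k + 1 + r) * q k (c + 2 * s - k - r)
    / (q k (c + 2 * s - k + 2 - r) * q k (c + k + r - 1))

section Letters

variable {s : ℕ} (z : ℕ → K) (q : ℕ → ℤ → K) {k t : ℕ}

theorem ospLetter_of_lt (hk : k < s) : ospLetter s z q k = plainLetter z q k := if_pos hk

theorem ospLetter_self : ospLetter s z q s = zeroLetter s q := by
  rw [ospLetter, if_neg (lt_irrefl s), if_pos rfl]

theorem ospLetter_two_mul_sub (hk : k < s) : ospLetter s z q (2 * s - k) = barLetter s z q k := by
  rw [ospLetter, if_neg (by omega), if_neg (by omega), Nat.sub_sub_self (by omega)]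

variable {z q} (hk : ∀ c, q k c ≠ 0) (hk1 : ∀ c, q (k + 1) c ≠ 0)

include hk hk1

theorem plainLetter_mul_dualFactor (hs : k + (t + 1) = s) (r c : ℤ) :
    plainLetter z q k (c + r - 1) * dualFactor s q (k + 1) (r - 1) (c - 1)
      = dualFactor s q k r c * plainLetter z q k (c + (2 * t + 3 - r) - 1) := by
  subst hs
  simp only [plainLetter, dualFactor]
  push_cast
  ring_nf at hk1 ⊢
  field_simp [hk, hk1]

theorem barLetter_mul_dualFactor (hs : k + (t + 1) = s) (r c : ℤ) :
    barLetter s z q k (c - r + 1) * dualFactor s q (k + 1) (r - 1) (c + 1)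
      = dualFactor s q k r c * barLetter s z q k (c - (2 * t + 3 - r) + 1) := by
  subst hs
  simp only [barLetter, dualFactor]
  push_cast
  ring_nf at hk1 ⊢
  field_simp [hk, hk1]

theorem plainLetter_mul_barLetter_mul_dualFactor (hz : z k * z k = 1) (hs : k + (t + 1) = s)
    (r c : ℤ) :
    plainLetter z q k (c + r - 1) * barLetter s z q k (c - r + 1)
        * dualFactor s q (k + 1) (r - 2) c
      = dualFactor s q k r c := by
  subst hs
  simp only [plainLetter, barLetter, dualFactor]
  push_cast
  ring_nf at hk1 ⊢
  field_simp [hk, hk1]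
  linear_combination hz

theorem dualFactor_mul_plainLetter_mul_barLetter (hz : z k * z k = 1) (hs : k + (t + 1) = s)
    (r c : ℤ) :
    dualFactor s q k r c * (plainLetter z q k (c + (2 * t + 3 - r) - 1)
        * barLetter s z q k (c - (2 * t + 3 - r) + 1))
      = dualFactor s q (k + 1) r c := by
  subst hs
  simp only [plainLetter, barLetter, dualFactor]
  push_cast
  ring_nf at hk1 ⊢
  field_simp [hk, hk1]
  linear_combination hz

end Letters

theorem elemSum_zeroLetter_dual {s : ℕ} {q : ℕ → ℤ → K} (hq : ∀ c, q s c ≠ 0) (r c : ℤ) :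
    elemSum (fun _ => zeroLetter s q) 1 r c
      = dualFactor s q s r c * elemSum (fun _ => zeroLetter s q) 1 (1 - r) c := by
  simp only [elemSum_succ, elemSum_zero, zeroLetter, dualFactor]
  rcases eq_or_ne r 0 with rfl | h0
  · norm_num
    ring_nf
    field_simp [hq]
  · rcases eq_or_ne r 1 with rfl | h1
    · norm_num
      ring_nf
    · simp [h0, sub_ne_zero.2 h1, sub_ne_zero.2 h1.symm]

theorem elemSum_ospLetter_add_two {s k t : ℕ} (z : ℕ → K) (q : ℕ → ℤ → K)
    (hs : k + (t + 1) = s) (r c : ℤ) :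
    elemSum (fun p => ospLetter s z q (k + p)) (2 * t + 3) r c
      = elemSum (fun p => ospLetter s z q (k + 1 + p)) (2 * t + 1) r c
        + plainLetter z q k (c + r - 1)
          * elemSum (fun p => ospLetter s z q (k + 1 + p)) (2 * t + 1) (r - 1) (c - 1)
        + barLetter s z q k (c - r + 1)
          * elemSum (fun p => ospLetter s z q (k + 1 + p)) (2 * t + 1) (r - 1) (c + 1)
        + plainLetter z q k (c + r - 1) * barLetter s z q k (c - r + 1)
          * elemSum (fun p => ospLetter s z q (k + 1 + p)) (2 * t + 1) (r - 2) c := by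
  have hfirst : ospLetter s z q (k + 0) = plainLetter z q k := ospLetter_of_lt z q (by omega)
  have hlast : ospLetter s z q (k + (2 * t + 1 + 1)) = barLetter s z q k := by
    rw [← ospLetter_two_mul_sub z q (by omega : k < s)]
    congr 1
    omega
  have hinner : (fun p => ospLetter s z q (k + (p + 1))) = fun p => ospLetter s z q (k + 1 + p) :=
    funext fun p => by rw [add_right_comm, add_assoc]
  rw [elemSum_add_two, hfirst, hlast, hinner]

theorem elemSum_ospLetter_dual {s : ℕ} {z : ℕ → K} {q : ℕ → ℤ → K}
    (hq : ∀ a ≤ s, ∀ c, q a c ≠ 0) (hz : ∀ a, z a * z a = 1) {k t : ℕ} (hs : k + t = s)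
    (r c : ℤ) :
    elemSum (fun p => ospLetter s z q (k + p)) (2 * t + 1) r c
      = dualFactor s q k r c
        * elemSum (fun p => ospLetter s z q (k + p)) (2 * t + 1) (2 * t + 1 - r) c := by
  induction t generalizing k r c with
  | zero =>
    obtain rfl : k = s := hs
    simpa [elemSum_succ, elemSum_zero, ospLetter_self] using
      elemSum_zeroLetter_dual (hq k le_rfl) r c
  | succ t ih =>
    have hk := hq k (by omega)
    have hk1 := hq (k + 1) (by omega)
    have hinner := ih (k := k + 1) (by omega)
    -- Complementing the degree exchanges words with both outer letters and words with neither.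
    have hplain := plainLetter_mul_dualFactor (z := z) hk hk1 hs r c
    have hbar := barLetter_mul_dualFactor (z := z) hk hk1 hs r c
    have hboth := plainLetter_mul_barLetter_mul_dualFactor hk hk1 (hz k) hs r c
    have hneither := dualFactor_mul_plainLetter_mul_barLetter hk hk1 (hz k) hs r c
    rw [show 2 * (t + 1) + 1 = 2 * t + 3 by ring,
      show 2 * ((t + 1 : ℕ) : ℤ) + 1 - r = 2 * t + 3 - r by push_cast; ring,
      elemSum_ospLetter_add_two z q hs, elemSum_ospLetter_add_two z q hs,
      hinner r c, hinner (r - 1) (c - 1), hinner (r - 1) (c + 1), hinner (r - 2) c,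
      show 2 * (t : ℤ) + 1 - (r - 1) = 2 * t + 3 - r - 1 by ring,
      show 2 * (t : ℤ) + 1 - (r - 2) = 2 * t + 3 - r by ring,
      show 2 * (t : ℤ) + 1 - r = 2 * t + 3 - r - 2 by ring]
    let A := elemSum (fun p => ospLetter s z q (k + 1 + p)) (2 * t + 1)
    linear_combination A (2 * t + 3 - r) c * hboth
      + A (2 * t + 3 - r - 1) (c - 1) * hplain + A (2 * t + 3 - r - 1) (c + 1) * hbar
      - A (2 * t + 3 - r - 2) c * hneither

theorem prod_fin_div_eq_div {f : ℤ → K} (hf : ∀ c, f c ≠ 0) (m : ℕ) (u : ℤ) :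
    ∏ j : Fin m, f (u + 2 * j + 2) / f (u + 2 * j) = f (u + 2 * m) / f u := by
  rw [← Finset.prod_range fun j => f (u + 2 * j + 2) / f (u + 2 * j)]
  refine Finset.prod_range_induction _ (fun j : ℕ => f (u + 2 * j) / f u) ?_ m fun j _ => ?_
  · rw [Nat.cast_zero, mul_zero, add_zero, div_self (hf u)]
  · rw [div_mul_div_cancel₀' (hf _), Nat.cast_succ, mul_add_one, ← add_assoc]

theorem rectangleDet_ospLetter_dual {s : ℕ} {z : ℕ → K} {q : ℕ → ℤ → K}
    (hq : ∀ a ≤ s, ∀ c, q a c ≠ 0) (hz : ∀ a, z a * z a = 1) (m : ℕ) (a c : ℤ) :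
    rectangleDet (ospLetter s z q) (2 * s + 1) a m c
      = q 0 (c + a + m) / q 0 (c + a - m)
        * (q 0 (c - a - m + 2 * s + 1) / q 0 (c - a + m + 2 * s + 1))
        * rectangleDet (ospLetter s z q) (2 * s + 1) (2 * s + 1 - a) m c := by
  have hq0 := hq 0 s.zero_le
  have hcol := prod_fin_div_eq_div hq0 m (c + a - m)
  have hrow := prod_fin_div_eq_div (fun x => inv_ne_zero (hq0 x)) m (c - a - m + 2 * s + 1)
  simp only [inv_div_inv] at hrow
  let E := Matrix.of fun i j : Fin m =>
    elemSum (ospLetter s z q) (2 * s + 1) (2 * s + 1 - a - i + j) (c + i + j + 1 - m)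
  have hentry : (Matrix.of fun i j : Fin m =>
      elemSum (ospLetter s z q) (2 * s + 1) (a - i + j) (c + i + j + 1 - m))
      = Matrix.of fun i j : Fin m => q 0 (c + a - m + 2 * j + 2) / q 0 (c + a - m + 2 * j)
        * Matrix.of (fun i j : Fin m => q 0 (c - a - m + 2 * s + 1 + 2 * i)
          / q 0 (c - a - m + 2 * s + 1 + 2 * i + 2) * E.transpose i j) i j := by
    ext i j
    have hdual := elemSum_ospLetter_dual hq hz (zero_add s) (a - i + j) (c + i + j + 1 - m)
    simp only [zero_add] at hdual
    rw [Matrix.of_apply, hdual, dualFactor]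
    simp only [Matrix.of_apply, Matrix.transpose_apply, E]
    push_cast
    ring_nf
  rw [rectangleDet_eq_det, rectangleDet_eq_det, hentry, Matrix.det_mul_row, Matrix.det_mul_column,
    Matrix.det_transpose, hcol, hrow, ← mul_assoc,
    show c + a - m + 2 * m = c + a + m by ring,
    show c - a - m + 2 * s + 1 + 2 * m = c - a + m + 2 * s + 1 by ring]

end Duality

namespace OspData

variable {K : Type*} [Field K] [Algebra ℂ K]

theorem hi_zero : hi K 0 = 0 := by
  rw [hi, Int.cast_zero, zero_mul, zero_div, map_zero]

theorem hi_add (a b : ℤ) : hi K (a + b) = hi K a + hi K b := by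
  rw [hi, hi, hi, ← map_add, Int.cast_add, add_mul, add_div]

theorem hi_sub (a b : ℤ) : hi K (a - b) = hi K a - hi K b := by
  rw [hi, hi, hi, ← map_sub, Int.cast_sub, sub_mul, sub_div]

theorem add_hi_zero (v : K) : v + hi K 0 = v := by rw [hi_zero, add_zero]

theorem sub_hi (v : K) (a : ℤ) : v - hi K a = v + hi K (-a) := by
  rw [← zero_sub a, hi_sub, hi_zero, zero_sub, sub_eq_add_neg]

theorem add_hi_add (v : K) (a b : ℤ) : v + hi K a + hi K b = v + hi K (a + b) := by
  rw [hi_add, add_assoc]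

theorem add_hi_sub (v : K) (a b : ℤ) : v + hi K a - hi K b = v + hi K (a - b) := by
  rw [hi_sub, add_sub_assoc]

/-- The values of `f` at the points `v + c * i / 2`, as a function of the integer `c`. -/
noncomputable def sample (f : K → K) (v : K) (c : ℤ) : K := f (v + hi K c)

variable (D : OspData)

theorem phiP_add_hi (v : K) (c : ℤ) : D.phiP (v + hi K c) = sample D.phiP v c := rfl

theorem phiM_add_hi (v : K) (c : ℤ) : D.phiM (v + hi K c) = sample D.phiM v c := rfl

theorem Q_add_hi (a : ℕ) (v : K) (c : ℤ) : D.Q a (v + hi K c) = sample (D.Q a) v c := rfl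

theorem sample_Q_zero (v : K) (c : ℤ) : sample (D.Q 0) v c = 1 := rfl

theorem zeta_mul_self {F : Type*} [Field F] (a : ℕ) : D.zeta F a * D.zeta F a = 1 := by
  have hsign (n : ℤ) : (-1 : F) ^ n * (-1) ^ n = 1 := by
    rw [← mul_zpow, neg_one_mul, neg_neg, one_zpow]
  rw [zeta]
  split_ifs <;> exact hsign _

/-- The functions `φ₊`, `φ₋` and `Q_a`, hence all denominators of the dressed vacuum forms, vanish
at no point `v + c * i / 2`. -/
def IsRegular (v : K) : Prop :=
  ∀ c : ℤ, D.phiP (v + hi K c) ≠ 0 ∧ D.phiM (v + hi K c) ≠ 0 ∧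
    ∀ a ≤ D.s, D.Q a (v + hi K c) ≠ 0

theorem isRegular_of_notMem_range {v : K} (hv : v ∉ Set.range (algebraMap ℂ K)) :
    D.IsRegular v := by
  have hne (x y : ℂ) : v + algebraMap ℂ K x - algebraMap ℂ K y ≠ 0 := by
    intro h
    exact hv ⟨y - x, by rw [map_sub]; linear_combination -h⟩
  refine fun c => ⟨pow_ne_zero _ ?_, pow_ne_zero _ (hne _ _), fun a _ => ?_⟩
  · rw [← sub_neg_eq_add, ← map_neg]
    exact hne _ _
  · rw [Q]
    split_ifs
    · exact one_ne_zero
    · exact Finset.prod_ne_zero_iff.2 fun k _ => hne _ _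

theorem isRegular_X : D.IsRegular (RatFunc.X : RatFunc ℂ) := by
  refine D.isRegular_of_notMem_range ?_
  rintro ⟨x, hx⟩
  exact RatFunc.transcendental_X (hx ▸ isAlgebraic_algebraMap x)

/-- The functions `Q_a` sampled at `v + c * i / 2`, with `Q_0` replaced by
`φ₋(x) φ₊(x - (2 s + 1) i / 2)`. This choice turns the exceptional vacuum parts of the letters `1`
and `1̄` into the generic ones. -/
noncomputable def dressedQ (v : K) (a : ℕ) : ℤ → K :=
  if a = 0 then fun c => sample D.phiM v c * sample D.phiP v (c - 2 * D.s - 1)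
  else sample (D.Q a) v

theorem dressedQ_zero (v : K) (c : ℤ) :
    D.dressedQ v 0 c = sample D.phiM v c * sample D.phiP v (c - 2 * D.s - 1) := rfl

theorem dressedQ_of_ne_zero (v : K) {a : ℕ} (ha : a ≠ 0) : D.dressedQ v a = sample (D.Q a) v :=
  if_neg ha

/-- The weights of the letters, at the points `v + c * i / 2`, divided by the vacuum factor
`φ₊ φ₋`. -/
noncomputable def reducedBox (v : K) : ℕ → ℤ → K :=
  ospLetter D.s (fun k => D.zeta K (k + 1)) (D.dressedQ v)

/-- The vacuum factor `φ₊ φ₋` of all boxes of the rectangle with `m` rows and `a` columns centred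
at `v + c * i / 2`. -/
noncomputable def vacuumProd (v : K) (a m : ℕ) (c : ℤ) : K :=
  ∏ j : Fin m, ∏ k : Fin a, (sample D.phiP v (c + a - m + 2 * (j - k))
    * sample D.phiM v (c + a - m + 2 * (j - k)))

theorem norm_eq (v : K) (a m : ℕ) (c : ℤ) :
    D.norm a m (v + hi K c) = D.vacuumProd v a m c
      / (sample D.phiM v (c + a - m) * sample D.phiP v (c - a + m)) := by
  simp only [norm, vacuumProd, add_hi_sub, add_hi_add, phiP_add_hi, phiM_add_hi,
    mul_comm (sample D.phiP _ _)]
  ring_nf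

theorem T_zero_right (a : ℕ) (v : K) :
    D.T a 0 v = D.phiM (v + hi K a) * D.phiP (v - hi K a) := by
  simp [T, dvf, norm, Admissible, sub_hi, Subsingleton.monotone]

theorem T_zero_left (m : ℕ) (v : K) :
    D.T 0 m v = D.phiM (v - hi K m) * D.phiP (v + hi K m) := by
  simp [T, dvf, norm, Admissible, Subsingleton.strictMono]

section Regular

variable {D} {v : K} (hv : D.IsRegular v)

include hv

theorem IsRegular.sample_phiP_ne_zero (c : ℤ) : sample D.phiP v c ≠ 0 := (hv c).1

theorem IsRegular.sample_phiM_ne_zero (c : ℤ) : sample D.phiM v c ≠ 0 := (hv c).2.1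

theorem IsRegular.dressedQ_ne_zero {a : ℕ} (ha : a ≤ D.s) (c : ℤ) : D.dressedQ v a c ≠ 0 := by
  rw [dressedQ]
  split_ifs
  · exact mul_ne_zero (hv.sample_phiM_ne_zero _) (hv.sample_phiP_ne_zero _)
  · exact (hv c).2.2 a ha

theorem IsRegular.vacuumProd_ne_zero (a m : ℕ) (c : ℤ) : D.vacuumProd v a m c ≠ 0 :=
  Finset.prod_ne_zero_iff.2 fun _ _ => Finset.prod_ne_zero_iff.2 fun _ _ =>
    mul_ne_zero (hv.sample_phiP_ne_zero _) (hv.sample_phiM_ne_zero _)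

theorem IsRegular.boxPlain_eq (k : ℕ) (c : ℤ) :
    D.boxPlain (k + 1) (v + hi K c) = sample D.phiP v c * sample D.phiM v c
      * plainLetter (fun k => D.zeta K (k + 1)) (D.dressedQ v) k c := by
  have hM := hv.sample_phiM_ne_zero
  have hP := hv.sample_phiP_ne_zero
  simp only [boxPlain, psi, plainLetter, add_hi_add, add_hi_sub, phiP_add_hi, phiM_add_hi,
    Q_add_hi, Nat.add_sub_cancel, D.dressedQ_of_ne_zero v k.add_one_ne_zero]
  rcases k with _ | k
  · simp only [dressedQ_zero, sample_Q_zero, if_true, zero_add]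
    push_cast
    ring_nf
    field_simp [hM, hP]
  · rw [if_neg (by omega), D.dressedQ_of_ne_zero v k.add_one_ne_zero]
    push_cast
    ring_nf

theorem IsRegular.boxBar_eq (k : ℕ) (c : ℤ) :
    D.boxBar (k + 1) (v + hi K c) = sample D.phiP v c * sample D.phiM v c
      * barLetter D.s (fun k => D.zeta K (k + 1)) (D.dressedQ v) k c := by
  have hM := hv.sample_phiM_ne_zero
  have hP := hv.sample_phiP_ne_zero
  simp only [boxBar, psiBar, barLetter, add_hi_add, add_hi_sub, phiP_add_hi, phiM_add_hi,
    Q_add_hi, Nat.add_sub_cancel, D.dressedQ_of_ne_zero v k.add_one_ne_zero]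
  rcases k with _ | k
  · simp only [dressedQ_zero, sample_Q_zero, if_true, zero_add]
    push_cast
    ring_nf
    field_simp [hM, hP]
  · rw [if_neg (by omega), D.dressedQ_of_ne_zero v k.add_one_ne_zero]
    push_cast
    ring_nf

variable (hs : 1 ≤ D.s)

include hs

theorem IsRegular.box_eq (p : D.Letter) (c : ℤ) :
    D.box p (v + hi K c) = sample D.phiP v c * sample D.phiM v c * D.reducedBox v p c := by
  rw [box, reducedBox, ospLetter]
  split_ifs
  · exact hv.boxPlain_eq _ c
  · simp only [boxZero, psiZero, zeroLetter, D.dressedQ_of_ne_zero v (Nat.one_le_iff_ne_zero.1 hs),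
      add_hi_add, phiP_add_hi, phiM_add_hi, Q_add_hi]
    simp only [add_sub_assoc, add_assoc]
  · rw [Nat.sub_add_comm (Nat.le_of_lt_succ p.is_lt)]
    exact hv.boxBar_eq _ c

theorem IsRegular.dvf_eq (a m : ℕ) (c : ℤ) :
    D.dvf a m (v + hi K c)
      = D.vacuumProd v a m c * rectangleDet (D.reducedBox v) (2 * D.s + 1) a m c := by
  classical
  rw [rectangleDet, ← sum_rectangle_eq_jacobiTrudi, dvf, Finset.mul_sum]
  refine Finset.sum_congr (Finset.filter_congr fun b _ => Iff.rfl) fun b _ => ?_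
  simp only [vacuumProd, ← Finset.prod_mul_distrib]
  refine Finset.prod_congr rfl fun j _ => Finset.prod_congr rfl fun k _ => ?_
  rw [add_hi_sub, hv.box_eq hs,
    show c - (-(a : ℤ) + m - 2 * j + 2 * k) = c + a - m + 2 * (j - k) by ring]

theorem IsRegular.T_eq (a m : ℕ) (c : ℤ) :
    D.T a m (v + hi K c) = rectangleDet (D.reducedBox v) (2 * D.s + 1) a m c
      * (sample D.phiM v (c + a - m) * sample D.phiP v (c - a + m)) := by
  rw [T, hv.dvf_eq hs, norm_eq, div_div_eq_mul_div, mul_assoc,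
    mul_div_cancel_left₀ _ (hv.vacuumProd_ne_zero a m c)]

theorem IsRegular.T_mul_T (a m : ℕ) :
    D.T (a + 1) (m + 1) (v + hi K 1) * D.T (a + 1) (m + 1) (v - hi K 1)
      = D.T (a + 1) (m + 2) v * D.T (a + 1) m v + D.T a (m + 1) v * D.T (a + 2) (m + 1) v := by
  have hT (a m : ℕ) : D.T a m v = rectangleDet (D.reducedBox v) (2 * D.s + 1) a m 0
      * (sample D.phiM v (0 + a - m) * sample D.phiP v (0 - a + m)) := by
    rw [← hv.T_eq hs, add_hi_zero]
  have hdet := rectangleDet_mul_rectangleDet (D.reducedBox v) (2 * D.s + 1) m (a + 1) 0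
  simp only [sub_hi, hT, hv.T_eq hs]
  push_cast
  ring_nf at hdet ⊢
  linear_combination sample D.phiM v (1 + a - m) * sample D.phiP v (1 - a + m)
    * sample D.phiM v (-1 + a - m) * sample D.phiP v (-1 - a + m) * hdet

theorem IsRegular.T_succ_s (m : ℕ) : D.T (D.s + 1) m v = D.g m v * D.T D.s m v := by
  have hM := hv.sample_phiM_ne_zero
  have hP := hv.sample_phiP_ne_zero
  have hdual := rectangleDet_ospLetter_dual (s := D.s) (fun _ => hv.dressedQ_ne_zero)
    (fun k => D.zeta_mul_self (F := K) (k + 1)) m (D.s + 1) 0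
  rw [← reducedBox, show 2 * (D.s : ℤ) + 1 - (D.s + 1) = D.s by ring] at hdual
  rw [← add_hi_zero v, hv.T_eq hs, hv.T_eq hs, g, Nat.cast_succ, hdual]
  simp only [add_hi_add, add_hi_sub, phiP_add_hi, phiM_add_hi, dressedQ_zero]
  ring_nf
  field_simp [hM, hP]

end Regular

end OspData

theorem mainTheorem3_general (D : OspData) {K : Type*} [Field K] [Algebra ℂ K] (hs : 1 ≤ D.s)
    {v : K} (hv : D.IsRegular v) :
    (∀ a : ℕ, 1 ≤ a → ∀ m : ℕ, 1 ≤ m →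
      D.T a m (v + OspData.hi _ 1) * D.T a m (v - OspData.hi _ 1)
        = D.T a (m + 1) v * D.T a (m - 1) v + D.T (a - 1) m v * D.T (a + 1) m v) ∧
    (∀ m : ℕ, 1 ≤ m →
      D.T D.s m (v + OspData.hi _ 1) * D.T D.s m (v - OspData.hi _ 1)
        = D.T D.s (m + 1) v * D.T D.s (m - 1) v
          + D.g m v * D.T (D.s - 1) m v * D.T D.s m v) ∧
    (∀ a : ℕ, D.T a 0 v = D.phiM (v + OspData.hi _ a) * D.phiP (v - OspData.hi _ a)) ∧
    (∀ m : ℕ, D.T 0 m v = D.phiM (v - OspData.hi _ m) * D.phiP (v + OspData.hi _ m)) := by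
  have hT (a : ℕ) (ha : 1 ≤ a) (m : ℕ) (hm : 1 ≤ m) :
      D.T a m (v + OspData.hi _ 1) * D.T a m (v - OspData.hi _ 1)
        = D.T a (m + 1) v * D.T a (m - 1) v + D.T (a - 1) m v * D.T (a + 1) m v := by
    obtain ⟨a, rfl⟩ := Nat.exists_eq_add_of_le' ha
    obtain ⟨m, rfl⟩ := Nat.exists_eq_add_of_le' hm
    exact hv.T_mul_T hs a m
  refine ⟨hT, fun m hm => ?_, fun a => D.T_zero_right a v, fun m => D.T_zero_left m v⟩
  rw [hT D.s hs m hm, hv.T_succ_s hs m, mul_left_comm, mul_assoc]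

theorem mainTheorem3 (D : OspData) (hs : 1 ≤ D.s) (hN : Even D.N)
    (v : RatFunc ℂ) (hv : v = RatFunc.X) :
    (∀ a : ℕ, 1 ≤ a → a < D.s → ∀ m : ℕ, 1 ≤ m →
      D.T a m (v + OspData.hi _ 1) * D.T a m (v - OspData.hi _ 1)
        = D.T a (m + 1) v * D.T a (m - 1) v + D.T (a - 1) m v * D.T (a + 1) m v) ∧
    (∀ m : ℕ, 1 ≤ m →
      D.T D.s m (v + OspData.hi _ 1) * D.T D.s m (v - OspData.hi _ 1)
        = D.T D.s (m + 1) v * D.T D.s (m - 1) v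
          + D.g m v * D.T (D.s - 1) m v * D.T D.s m v) ∧
    (∀ a : ℕ, 1 ≤ a →
      D.T a 0 v = D.phiM (v + OspData.hi _ a) * D.phiP (v - OspData.hi _ a)) ∧
    (∀ m : ℕ, 1 ≤ m →
      D.T 0 m v = D.phiM (v - OspData.hi _ m) * D.phiP (v + OspData.hi _ m)) := by
  subst hv
  obtain ⟨hT, hTs, hright, hleft⟩ := mainTheorem3_general D hs D.isRegular_X
  exact ⟨fun a ha _ => hT a ha, hTs, fun a _ => hright a, fun m _ => hleft m⟩
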